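/- Let $\mathbb{S}^n$ be the space of real symmetric $n\times n$ matrices with the Frobenius norm $\|\cdot\|$, let $\mathbb{S}^n_+\subset\mathbb{S}^n$ be the cone of positive semidefinite matrices, and let $\mathbb{N}^n$ be the set of real $n\times n$ matrices with nonnegative entries. Let $G\in\mathbb{S}^n$, and let $\overline{X}$ be the unique solution of $$\text{(P)}\qquad \min_{X\in\mathbb{S}^n}\ \Big\{\tfrac12\|X-G\|^2 \ \Big|\ X\in\mathbb{S}^n_+,\ X\in\mathbb{N}^n\Big\},$$ that is, the projection of $G$ onto the doubly nonnegative cone. Let $\theta(S,Z)=\tfrac12\|S+Z+G\|^2-\tfrac12\|G\|^2$, let $\mathcal{C}=\{(S,Z)\in\mathbb{S}^n\times\mathbb{S}^n \mid S\in\mathbb{S}^n_+,\ Z\in\mathbb{N}^n\}$, and let $\mathrm{SOL}_{\mathrm D}$ be the set of minimizers of $\theta$ over $\mathcal{C}$, that is, the solution set of the dual problem $$\text{(D)}\qquad -\min_{S,Z\in\mathbb{S}^n}\ \Big\{\tfrac12\|S+Z+G\|^2-\tfrac12\|G\|^2 \ \Big|\ S\in\mathbb{S}^n_+,\ Z\in\mathbb{N}^n\Big\}.$$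 Suppose that at least one of the following two conditions holds: (i) $\operatorname{rank}(\overline{X})\ge n-1$; (ii) there exists $(\widehat S,\widehat Z)\in\mathrm{SOL}_{\mathrm D}$ such that $\operatorname{rank}(\overline{X})+\operatorname{rank}(\widehat S)=n$. Then the quadratic growth condition of (D) holds at every $(\overline S,\overline Z)\in\mathrm{SOL}_{\mathrm D}$: there exist constants $\kappa>0$ and $\varepsilon>0$ such that $$\theta(S,Z)\ \ge\ \theta(\overline S,\overline Z)+\kappa\,\operatorname{dist}^2\big((S,Z),\mathrm{SOL}_{\mathrm D}\big)$$ for all $(S,Z)\in\mathcal{C}$ with $\|(S,Z)-(\overline S,\overline Z)\|\le\varepsilon$, where $\|(S,Z)\|=(\|S\|^2+\|Z\|^2)^{1/2}$ and $\operatorname{dist}$ is the distance in this norm. -/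

import Mathlib

open scoped Matrix.Norms.Frobenius

/-- The minimizers of `f` over the feasible set `C`. -/
def solutionSet {E : Type*} (f : E → ℝ) (C : Set E) : Set E :=
  {x | x ∈ C ∧ IsMinOn f C x}

/-- The quadratic growth condition for the problem of minimizing `f` over `C`, at the point `xbar`
(to be used at a point `xbar` of `solutionSet f C`). -/
def QuadraticGrowthAt {E : Type*} [PseudoMetricSpace E] (f : E → ℝ) (C : Set E) (xbar : E) : Prop :=
  ∃ κ : ℝ, 0 < κ ∧ ∃ ε : ℝ, 0 < ε ∧ ∀ x ∈ Metric.closedBall xbar ε ∩ C,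
    f x ≥ f xbar + κ * Metric.infDist x (solutionSet f C) ^ 2

/-- The real `n × n` matrices; `‖·‖` on this type is the Frobenius norm. -/
abbrev SqMat (n : ℕ) : Type := Matrix (Fin n) (Fin n) ℝ

/-- The cone of symmetric positive semidefinite matrices (`Matrix.PosSemidef` includes symmetry). -/
def psdCone (n : ℕ) : Set (SqMat n) := {X | X.PosSemidef}

/-- The cone of symmetric matrices with nonnegative entries. -/
def nonnegCone (n : ℕ) : Set (SqMat n) := {X | X.IsSymm ∧ ∀ i j, 0 ≤ X i j}

/-- The doubly nonnegative cone. -/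
def dnnCone (n : ℕ) : Set (SqMat n) := psdCone n ∩ nonnegCone n

/-- The objective `½‖X - G‖²` of the primal problem. -/
noncomputable def primalObj {n : ℕ} (G : SqMat n) (X : SqMat n) : ℝ :=
  1 / 2 * ‖X - G‖ ^ 2

/-- The solutions of the primal problem: minimize `½‖X - G‖²` over the doubly nonnegative cone. -/
def primalSol {n : ℕ} (G : SqMat n) : Set (SqMat n) :=
  solutionSet (primalObj G) (dnnCone n)

/-- Pairs `(S, Z)` of matrices, with the norm `(‖S‖² + ‖Z‖²)^(1/2)`. -/
abbrev MatPair (n : ℕ) : Type := WithLp 2 (SqMat n × SqMat n)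

/-- The objective `½‖S + Z + G‖² - ½‖G‖²` of the dual problem, which is to be minimized. -/
noncomputable def dualObj {n : ℕ} (G : SqMat n) (p : MatPair n) : ℝ :=
  1 / 2 * ‖p.fst + p.snd + G‖ ^ 2 - 1 / 2 * ‖G‖ ^ 2

/-- The feasible pairs of the dual problem: `S` positive semidefinite, `Z` symmetric and entrywise
nonnegative. -/
def dualFeasible (n : ℕ) : Set (MatPair n) := {p | p.fst ∈ psdCone n ∧ p.snd ∈ nonnegCone n}

/-- The solutions of the dual problem. -/
def dualSol {n : ℕ} (G : SqMat n) : Set (MatPair n) :=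
  solutionSet (dualObj G) (dualFeasible n)

/-! Write X for the primal solution and B = X - G. Every dual solution satisfies S + Z = B, and
conversely every feasible pair with that sum is a solution. So the dual solutions are the pairs (Y,
B - Y) with Y positive semidefinite and Y ≤ B entrywise. At a feasible (S, Z), the excess of the
objective over its minimum is exactly ⟨X, S⟩ + ⟨X, Z⟩ + ½‖S + Z - B‖², with all terms nonnegative.
It therefore suffices to find such a Y at distance from S of the order of ‖S + Z - B‖ + √⟨X, S⟩; the
term ⟨X, Z⟩ can be dropped.

Let Q project onto ker X. On bounded sets S is O(√⟨X, S⟩) away from QSQ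
(`exists_norm_sub_compression_le_sqrt`), and QSQ lies in the face of the semidefinite cone
orthogonal to X. On that face a linear error bound for Y ≤ B is needed (`exists_error_bound_face`).
Hoffman's bound repairs the entrywise inequalities but may lose semidefiniteness. If rank X ≥ n - 1,
the face consists of matrices of rank at most one, where semidefiniteness is the linear inequality
tr Y ≥ 0, so Hoffman's bound covers it too. Under strict complementarity, the first component of the
given dual solution is relatively interior to the face and satisfies the inequalities, so a small
convex step towards it restores semidefiniteness. -/

/-! ### Hoffman's error bound. -/

/-- By compactness the sum attains its minimum over unit vectors of the polar cone. If that minimum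
were zero, the minimizer would lie in both the cone and its polar, hence be orthogonal to itself. -/
theorem exists_pos_le_sum_max_of_normal {F : Type*} [NormedAddCommGroup F] [InnerProductSpace ℝ F]
    [FiniteDimensional ℝ F] {ι : Type*} (a : ι → F →L[ℝ] ℝ) (I : Finset ι) :
    ∃ c : ℝ, 0 < c ∧ ∀ u : F, ‖u‖ = 1 → (∀ d : F, (∀ i ∈ I, a i d ≤ 0) → inner ℝ u d ≤ 0) →
      c ≤ ∑ i ∈ I, max (a i u) 0 := by
  have hclosed : IsClosed {u : F | ∀ d : F, (∀ i ∈ I, a i d ≤ 0) → inner ℝ u d ≤ 0} := by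
    simp only [Set.ofPred_forall]
    refine isClosed_iInter fun d => isClosed_iInter fun _ => ?_
    exact isClosed_le (by fun_prop) continuous_const
  have hcompact := (isCompact_sphere (0 : F) 1).inter_right hclosed
  rcases Set.eq_empty_or_nonempty (Metric.sphere (0 : F) 1 ∩
    {u : F | ∀ d : F, (∀ i ∈ I, a i d ≤ 0) → inner ℝ u d ≤ 0}) with he | hne
  · refine ⟨1, one_pos, fun u hu hd => ?_⟩
    have : u ∈ (∅ : Set F) := he ▸ ⟨by simpa using hu, hd⟩
    exact this.elim
  · obtain ⟨v, ⟨hv1, hv⟩, hmin⟩ := hcompact.exists_isMinOn hne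
      (f := fun u => ∑ i ∈ I, max (a i u) 0) (by fun_prop)
    refine ⟨∑ i ∈ I, max (a i v) 0, ?_, fun u hu hd => hmin ⟨by simpa using hu, hd⟩⟩
    by_contra hle
    have hz : ∑ i ∈ I, max (a i v) 0 = 0 :=
      le_antisymm (not_lt.mp hle) (Finset.sum_nonneg fun _ _ => le_max_right _ _)
    rw [Finset.sum_eq_zero_iff_of_nonneg fun _ _ => le_max_right _ _] at hz
    have h := hv v fun i hi => max_eq_right_iff.mp (hz i hi)
    rw [real_inner_self_eq_norm_sq, mem_sphere_zero_iff_norm.mp hv1] at h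
    norm_num at h

/-- Hoffman's error bound in a Euclidean space. -/
theorem hoffman_euclidean {F : Type*} [NormedAddCommGroup F] [InnerProductSpace ℝ F]
    [FiniteDimensional ℝ F] {ι : Type*} [Fintype ι] (a : ι → F →L[ℝ] ℝ) (b : ι → ℝ)
    (hne : ∃ y, ∀ i, a i y ≤ b i) :
    ∃ C : ℝ, 0 ≤ C ∧ ∀ (x : F) (η : ℝ), 0 ≤ η → (∀ i, a i x ≤ b i + η) →
      ∃ y, (∀ i, a i y ≤ b i) ∧ ‖x - y‖ ≤ C * η := by
  classical
  choose c hc hcN using exists_pos_le_sum_max_of_normal a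
  have hnn : ∀ I : Finset ι, 0 ≤ Fintype.card ι * (c I)⁻¹ := fun I => by
    have := hc I
    positivity
  -- Summing over all index sets gives one constant valid whichever constraints are active at the
  -- projection of `x`.
  refine ⟨∑ I : Finset ι, Fintype.card ι * (c I)⁻¹, Finset.sum_nonneg fun I _ => hnn I, ?_⟩
  intro x η hη hx
  set P : Set F := {y | ∀ i, a i y ≤ b i} with hP
  have hPconv : Convex ℝ P := by
    simp only [hP, Set.ofPred_forall]
    exact convex_iInter fun i => convex_halfSpace_le (a i).isLinear (b i)
  have hPclosed : IsClosed P := by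
    simp only [hP, Set.ofPred_forall]
    exact isClosed_iInter fun i => isClosed_le (a i).continuous continuous_const
  have hPne : P.Nonempty := hne
  obtain ⟨y, hyP, hy⟩ := exists_norm_eq_iInf_of_complete_convex hPne hPclosed.isComplete hPconv x
  rw [norm_eq_iInf_iff_real_inner_le_zero hPconv hyP] at hy
  refine ⟨y, hyP, ?_⟩
  rcases eq_or_ne (x - y) 0 with h0 | h0
  · rw [h0, norm_zero]
    exact mul_nonneg (Finset.sum_nonneg fun I _ => hnn I) hη
  have hpos : 0 < ‖x - y‖ := norm_pos_iff.mpr h0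
  set I : Finset ι := Finset.univ.filter fun i => a i y = b i with hI
  set u : F := ‖x - y‖⁻¹ • (x - y) with hu
  have hu1 : ‖u‖ = 1 := by
    rw [hu, norm_smul, norm_inv, norm_norm, inv_mul_cancel₀ hpos.ne']
  -- A short step along `d` stays in `P`: active constraints do not increase, inactive ones have
  -- slack. The variational inequality of the projection then puts `u` in the normal cone.
  have hnormal : ∀ d : F, (∀ i ∈ I, a i d ≤ 0) → inner ℝ u d ≤ 0 := by
    intro d hd
    have hev : ∀ᶠ s : ℝ in nhdsWithin 0 (Set.Ioi 0), y + s • d ∈ P := by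
      simp only [hP, Set.mem_ofPred_eq]
      rw [Filter.eventually_all]
      intro i
      rcases (hyP i).eq_or_lt with hi | hi
      · filter_upwards [self_mem_nhdsWithin] with s hs
        have hd' := hd i (by simp [hI, hi])
        have : s * a i d ≤ 0 := mul_nonpos_of_nonneg_of_nonpos (le_of_lt hs) hd'
        simp only [map_add, map_smul, smul_eq_mul]
        linarith
      · have hcont : Continuous fun s : ℝ => a i (y + s • d) := by fun_prop
        have := (hcont.tendsto 0).eventually_lt_const (show a i (y + (0 : ℝ) • d) < b i by simpa)
        exact (this.filter_mono nhdsWithin_le_nhds).mono fun s hs => hs.le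
    obtain ⟨s, hs, hs0⟩ := (hev.and self_mem_nhdsWithin).exists
    have h := hy _ hs
    rw [add_sub_cancel_left, inner_smul_right] at h
    have h' : inner ℝ (x - y) d ≤ 0 := nonpos_of_mul_nonpos_right h hs0
    rw [hu, real_inner_smul_left]
    exact mul_nonpos_of_nonneg_of_nonpos (by positivity) h'
  have hcI := hcN I u hu1 hnormal
  have hbound : ∀ i ∈ I, max (a i u) 0 ≤ ‖x - y‖⁻¹ * η := by
    intro i hi
    have hi' : a i y = b i := by simpa [hI] using hi
    refine max_le ?_ (by positivity)
    rw [hu, map_smul, smul_eq_mul, map_sub, hi']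
    exact mul_le_mul_of_nonneg_left (by linarith [hx i]) (by positivity)
  have hsum : c I ≤ Fintype.card ι * (‖x - y‖⁻¹ * η) := by
    refine hcI.trans ((Finset.sum_le_card_nsmul _ _ _ hbound).trans ?_)
    rw [nsmul_eq_mul]
    gcongr
    exact Finset.card_le_univ I
  have hle : ‖x - y‖ ≤ Fintype.card ι * (c I)⁻¹ * η := by
    have hcI0 := hc I
    field_simp at hsum ⊢
    linarith
  refine hle.trans (mul_le_mul_of_nonneg_right ?_ hη)
  exact Finset.single_le_sum (f := fun I : Finset ι => (Fintype.card ι : ℝ) * (c I)⁻¹)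
    (fun I _ => hnn I) (Finset.mem_univ I)

/-- Hoffman's error bound for a consistent finite system of linear inequalities. -/
theorem hoffman {E : Type*} [NormedAddCommGroup E] [NormedSpace ℝ E]
    [FiniteDimensional ℝ E] {ι : Type*} [Fintype ι] (a : ι → E →ₗ[ℝ] ℝ) (b : ι → ℝ)
    (hne : ∃ y, ∀ i, a i y ≤ b i) :
    ∃ C : ℝ, 0 ≤ C ∧ ∀ (x : E) (η : ℝ), 0 ≤ η → (∀ i, a i x ≤ b i + η) →
      ∃ y, (∀ i, a i y ≤ b i) ∧ ‖x - y‖ ≤ C * η := by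
  let e := toEuclidean (E := E)
  obtain ⟨C, hC, h⟩ := hoffman_euclidean
    (fun i => (LinearMap.toContinuousLinearMap (a i)).comp
      (e.symm : EuclideanSpace ℝ (Fin (Module.finrank ℝ E)) →L[ℝ] E)) b
    (hne.imp' e fun y hy i => by simpa using hy i)
  refine ⟨‖(e.symm : EuclideanSpace ℝ (Fin (Module.finrank ℝ E)) →L[ℝ] E)‖ * C,
    by positivity, fun x η hη hx => ?_⟩
  obtain ⟨y, hy, hxy⟩ := h (e x) η hη fun i => by simpa using hx i
  refine ⟨e.symm y, hy, ?_⟩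
  have := (e.symm : EuclideanSpace ℝ (Fin (Module.finrank ℝ E)) →L[ℝ] E).le_opNorm (e x - y)
  simp only [map_sub, ContinuousLinearEquiv.coe_coe, ContinuousLinearEquiv.symm_apply_apply] at this
  calc _ ≤ _ := this
    _ ≤ _ := by rw [mul_assoc]; gcongr

/-! ### The Frobenius inner product. -/

section

open Matrix

variable {n : ℕ}

/-- The Frobenius inner product `tr (Aᵀ B)`. -/
def frobInner (A B : SqMat n) : ℝ := (Aᵀ * B).trace

theorem frobInner_eq_sum (A B : SqMat n) :
    frobInner A B = ∑ q : Fin n × Fin n, A q.1 q.2 * B q.1 q.2 := by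
  rw [Fintype.sum_prod_type, Finset.sum_comm]
  simp [frobInner, trace, mul_apply]

theorem frobInner_comm (A B : SqMat n) : frobInner A B = frobInner B A := by
  simp only [frobInner_eq_sum, mul_comm]

theorem frobInner_add_right (A B C : SqMat n) :
    frobInner A (B + C) = frobInner A B + frobInner A C := by
  simp [frobInner, mul_add]

theorem frobInner_add_left (A B C : SqMat n) :
    frobInner (A + B) C = frobInner A C + frobInner B C := by
  simp [frobInner, add_mul]

theorem frobInner_smul_right (c : ℝ) (A B : SqMat n) :
    frobInner A (c • B) = c * frobInner A B := by
  simp [frobInner]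

theorem frobInner_sub_right (A B C : SqMat n) :
    frobInner A (B - C) = frobInner A B - frobInner A C := by
  simp [frobInner, mul_sub]

theorem norm_sq_eq_frobInner (A : SqMat n) : ‖A‖ ^ 2 = frobInner A A := by
  have h0 : 0 ≤ ∑ i, ∑ j, A i j ^ 2 :=
    Finset.sum_nonneg fun i _ => Finset.sum_nonneg fun j _ => sq_nonneg _
  rw [frobenius_norm_def, frobInner_eq_sum, Fintype.sum_prod_type]
  simp only [Real.norm_eq_abs, Real.rpow_two, sq_abs]
  rw [← Real.sqrt_eq_rpow, Real.sq_sqrt h0]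
  simp only [sq]

theorem norm_add_sq_frobInner (A B : SqMat n) :
    ‖A + B‖ ^ 2 = ‖A‖ ^ 2 + 2 * frobInner A B + ‖B‖ ^ 2 := by
  simp only [norm_sq_eq_frobInner, frobInner_add_left, frobInner_add_right, frobInner_comm B A]
  ring

theorem abs_frobInner_le (A B : SqMat n) : |frobInner A B| ≤ ‖A‖ * ‖B‖ := by
  refine abs_le_of_sq_le_sq ?_ (by positivity)
  rw [mul_pow, norm_sq_eq_frobInner, norm_sq_eq_frobInner]
  simp only [frobInner_eq_sum, ← sq]
  exact Finset.sum_mul_sq_le_sq_mul_sq _ _ _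

theorem abs_entry_le_norm (A : SqMat n) (i j : Fin n) : |A i j| ≤ ‖A‖ := by
  refine abs_le_of_sq_le_sq ?_ (norm_nonneg _)
  rw [norm_sq_eq_frobInner, frobInner_eq_sum, sq]
  exact Finset.single_le_sum (f := fun q : Fin n × Fin n => A q.1 q.2 * A q.1 q.2)
    (fun q _ => mul_self_nonneg _) (Finset.mem_univ (i, j))

theorem frobInner_vecMulVec (A : SqMat n) (v : Fin n → ℝ) :
    frobInner A (vecMulVec v v) = v ⬝ᵥ A *ᵥ v := by
  rw [frobInner_eq_sum, Fintype.sum_prod_type]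
  simp only [vecMulVec_apply, dotProduct, mulVec, Finset.mul_sum]
  exact Finset.sum_congr rfl fun i _ => Finset.sum_congr rfl fun j _ => by ring

theorem norm_vecMulVec_self (v : Fin n → ℝ) : ‖vecMulVec v v‖ = v ⬝ᵥ v := by
  have h0 : 0 ≤ v ⬝ᵥ v := Finset.sum_nonneg fun i _ => mul_self_nonneg _
  rw [← sq_eq_sq₀ (norm_nonneg _) h0, norm_sq_eq_frobInner, frobInner_vecMulVec,
    vecMulVec_mulVec, sq]
  simp

/-! ### Positive semidefinite matrices. -/

theorem posSemidef_exists_factor {A : SqMat n} (h : A.PosSemidef) : ∃ R : SqMat n, A = Rᵀ * R := by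
  open scoped MatrixOrder in
  obtain ⟨R, hR⟩ := CStarAlgebra.nonneg_iff_eq_star_mul_self.mp (nonneg_iff_posSemidef.mpr h)
  exact ⟨R, hR⟩

theorem posSemidef_isSymm {A : SqMat n} (h : A.PosSemidef) : Aᵀ = A := h.1

theorem frobInner_factor (R Y : SqMat n) :
    frobInner (Rᵀ * R) (Yᵀ * Y) = ‖R * Yᵀ‖ ^ 2 := by
  rw [norm_sq_eq_frobInner, frobInner, frobInner]
  simp only [transpose_mul, transpose_transpose]
  rw [← Matrix.mul_assoc, trace_mul_comm]
  simp only [Matrix.mul_assoc]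

theorem posSemidef_frobInner_nonneg {A B : SqMat n} (hA : A.PosSemidef) (hB : B.PosSemidef) :
    0 ≤ frobInner A B := by
  obtain ⟨R, rfl⟩ := posSemidef_exists_factor hA
  obtain ⟨Y, rfl⟩ := posSemidef_exists_factor hB
  rw [frobInner_factor]
  positivity

theorem nonneg_frobInner_nonneg {A B : SqMat n} (hA : ∀ i j, 0 ≤ A i j) (hB : ∀ i j, 0 ≤ B i j) :
    0 ≤ frobInner A B := by
  rw [frobInner_eq_sum]
  exact Finset.sum_nonneg fun q _ => mul_nonneg (hA _ _) (hB _ _)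

/-- With S = RᵀR and X = YᵀY, the inner product is ‖RYᵀ‖² while SX = Rᵀ(RYᵀ)Y. This is the source of
the square root in the distance to the face. -/
theorem norm_mul_sq_le_of_posSemidef {S X : SqMat n} (hS : S.PosSemidef) (hX : X.PosSemidef) :
    ‖S * X‖ ^ 2 ≤ S.trace * X.trace * frobInner S X := by
  obtain ⟨R, rfl⟩ := posSemidef_exists_factor hS
  obtain ⟨Y, rfl⟩ := posSemidef_exists_factor hX
  have h1 : ‖(Rᵀ * R) * (Yᵀ * Y)‖ ≤ ‖R‖ * ‖R * Yᵀ‖ * ‖Y‖ := by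
    rw [show (Rᵀ * R) * (Yᵀ * Y) = Rᵀ * (R * Yᵀ) * Y by simp only [Matrix.mul_assoc]]
    refine (norm_mul_le _ _).trans (mul_le_mul_of_nonneg_right ?_ (norm_nonneg _))
    refine (norm_mul_le _ _).trans ?_
    rw [frobenius_norm_transpose]
  have h2 := pow_le_pow_left₀ (norm_nonneg _) h1 2
  rw [frobInner_factor]
  have hR : (Rᵀ * R).trace = ‖R‖ ^ 2 := by rw [norm_sq_eq_frobInner, frobInner]
  have hY : (Yᵀ * Y).trace = ‖Y‖ ^ 2 := by rw [norm_sq_eq_frobInner, frobInner]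
  rw [hR, hY]
  linarith [show (‖R‖ * ‖R * Yᵀ‖ * ‖Y‖) ^ 2 = ‖R‖ ^ 2 * ‖Y‖ ^ 2 * ‖R * Yᵀ‖ ^ 2 by ring]

theorem posSemidef_mul_eq_zero {S X : SqMat n} (hS : S.PosSemidef) (hX : X.PosSemidef)
    (h : frobInner S X = 0) : S * X = 0 := by
  have := norm_mul_sq_le_of_posSemidef hS hX
  rw [h, mul_zero] at this
  exact norm_eq_zero.mp (pow_eq_zero_iff two_ne_zero |>.mp (le_antisymm this (sq_nonneg _)))

theorem trace_le_norm (S : SqMat n) : S.trace ≤ ‖(1 : SqMat n)‖ * ‖S‖ := by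
  have := abs_frobInner_le 1 S
  simp only [frobInner, transpose_one, Matrix.one_mul] at this
  exact (le_abs_self _).trans this

theorem isHermitian_exists_diagonalization {X : SqMat n} (hX : X.IsHermitian) :
    ∃ (U : SqMat n) (l : Fin n → ℝ), star U * U = 1 ∧ U * star U = 1 ∧
      l = hX.eigenvalues ∧ X = U * diagonal l * star U := by
  refine ⟨hX.eigenvectorUnitary, hX.eigenvalues, Unitary.coe_star_mul_self _,
    Unitary.coe_mul_star_self _, rfl, ?_⟩
  have := hX.spectral_theorem
  rw [Unitary.conjStarAlgAut_apply] at this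
  exact this

/-- A symmetric matrix has a symmetric matrix that inverts it on its range and commutes with it. -/
theorem isHermitian_exists_pseudoinverse {X : SqMat n} (hX : X.IsHermitian) :
    ∃ W : SqMat n, Wᵀ = W ∧ X * W = W * X ∧ X * W * X = X := by
  obtain ⟨U, l, hU, -, -, rfl⟩ := isHermitian_exists_diagonalization hX
  have hmul : ∀ d e : Fin n → ℝ, (U * diagonal d * star U) * (U * diagonal e * star U) =
      U * diagonal (fun i => d i * e i) * star U := fun d e => by
    rw [show (U * diagonal d * star U) * (U * diagonal e * star U) =
      U * (diagonal d * ((star U * U) * diagonal e)) * star U by simp only [Matrix.mul_assoc],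
      hU, Matrix.one_mul, diagonal_mul_diagonal]
  refine ⟨U * diagonal (fun i => (l i)⁻¹) * star U, ?_, ?_, ?_⟩
  · simp [star_eq_conjTranspose, Matrix.mul_assoc]
  · simp only [hmul, mul_comm]
  · simp only [hmul, mul_inv_mul_cancel]

/-- At most one eigenvalue is nonzero, and it then equals the trace. -/
theorem posSemidef_of_rank_le_one {S : SqMat n} (hS : S.IsHermitian) (hr : S.rank ≤ 1)
    (ht : 0 ≤ S.trace) : S.PosSemidef := by
  rw [hS.posSemidef_iff_eigenvalues_nonneg]
  intro i
  rw [hS.rank_eq_card_non_zero_eigs, Fintype.card_le_one_iff] at hr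
  have hsum : S.trace = ∑ j, hS.eigenvalues j := by simpa using hS.trace_eq_sum_eigenvalues
  by_cases hi : hS.eigenvalues i = 0
  · exact hi.ge
  · rw [Finset.sum_eq_single i] at hsum
    · exact hsum ▸ ht
    · intro j _ hji
      by_contra hj
      exact hji (congrArg Subtype.val (hr ⟨j, hj⟩ ⟨i, hi⟩))
    · simp

theorem posSemidef_add_smul_one {M : SqMat n} (hM : M.IsHermitian) {c : ℝ} (hc : ‖M‖ ≤ c) :
    (M + c • (1 : SqMat n)).PosSemidef := by
  refine PosSemidef.of_dotProduct_mulVec_nonneg ?_ fun v => ?_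
  · exact hM.add (by simp [IsHermitian])
  · have h := abs_frobInner_le M (vecMulVec v v)
    rw [frobInner_vecMulVec, norm_vecMulVec_self] at h
    have h0 : 0 ≤ v ⬝ᵥ v := Finset.sum_nonneg fun i _ => mul_self_nonneg _
    have h1 := (abs_le.mp (h.trans (mul_le_mul_of_nonneg_right hc h0))).1
    simp only [star_trivial, add_mulVec, smul_mulVec, one_mulVec, dotProduct_add,
      dotProduct_smul, smul_eq_mul]
    linarith

theorem posDef_exists_sub_smul_one {M : SqMat n} (hM : M.PosDef) :
    ∃ c : ℝ, 0 < c ∧ (M - c • (1 : SqMat n)).PosSemidef := by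
  obtain ⟨c, hc, hle⟩ : ∃ c : ℝ, 0 < c ∧ ∀ i, c ≤ hM.1.eigenvalues i := by
    rcases isEmpty_or_nonempty (Fin n) with h | h
    · exact ⟨1, one_pos, fun i => h.elim i⟩
    · obtain ⟨i, hi⟩ := Finite.exists_min hM.1.eigenvalues
      exact ⟨_, hM.eigenvalues_pos i, hi⟩
  refine ⟨c, hc, ?_⟩
  obtain ⟨U, l, -, hU, hl, hs⟩ := isHermitian_exists_diagonalization hM.1
  rw [← hl] at hle
  have : M - c • (1 : SqMat n) = U * diagonal (fun i => l i - c) * Uᴴ := by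
    rw [← diagonal_sub, ← smul_one_eq_diagonal, Matrix.mul_sub, Matrix.sub_mul,
      ← star_eq_conjTranspose, ← hs]
    simp [hU]
  rw [this]
  exact (PosSemidef.diagonal fun i => sub_nonneg.mpr (hle i)).mul_mul_conjTranspose_same U

/-- Strict complementarity: a complementary pair of full total rank has positive definite sum. -/
theorem posDef_add_of_rank_add_rank {S X : SqMat n} (hS : S.PosSemidef) (hX : X.PosSemidef)
    (h0 : X * S = 0) (hr : X.rank + S.rank = n) : (S + X).PosDef := by
  -- The product condition gives the inclusion, the rank condition equality of dimensions. A vector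
  -- killed by both matrices is then `S *ᵥ w` with S²w = 0, hence zero.
  have hker : LinearMap.range S.mulVecLin = LinearMap.ker X.mulVecLin := by
    refine Submodule.eq_of_le_of_finrank_eq ?_ ?_
    · rintro _ ⟨v, rfl⟩
      simp [mulVec_mulVec, h0]
    · have := LinearMap.finrank_range_add_finrank_ker X.mulVecLin
      simp only [Module.finrank_fintype_fun_eq_card, Fintype.card_fin] at this
      unfold Matrix.rank at hr
      omega
  refine PosDef.of_dotProduct_mulVec_pos (hS.1.add hX.1) fun v hv => ?_
  have hSv := hS.dotProduct_mulVec_nonneg v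
  have hXv := hX.dotProduct_mulVec_nonneg v
  rw [add_mulVec, dotProduct_add]
  by_contra hle
  have hSv0 : S *ᵥ v = 0 := (hS.dotProduct_mulVec_zero_iff v).mp (by linarith)
  have hXv0 : X *ᵥ v = 0 := (hX.dotProduct_mulVec_zero_iff v).mp (by linarith)
  have hmem : v ∈ LinearMap.range S.mulVecLin := by
    rw [hker]
    simpa using hXv0
  obtain ⟨w, rfl⟩ := hmem
  apply hv
  rw [mulVecLin_apply] at hSv0 ⊢
  have : (S *ᵥ w) ⬝ᵥ (S *ᵥ w) = 0 := by
    rw [dotProduct_mulVec, ← mulVec_transpose, posSemidef_isSymm hS, hSv0, zero_dotProduct]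
  exact dotProduct_self_eq_zero.mp this

/-! ### Faces of the semidefinite cone and error bounds on them. -/

/-- The orthogonal projection `Q` onto the kernel of a symmetric matrix `X`. -/
theorem exists_kernel_projection {X : SqMat n} (hX : X.IsHermitian) :
    ∃ Q W : SqMat n, Qᵀ = Q ∧ Q * Q = Q ∧ X * Q = 0 ∧ 1 - Q = X * W := by
  obtain ⟨W, hW, hc, hXWX⟩ := isHermitian_exists_pseudoinverse hX
  have hXt : Xᵀ = X := hX
  have hXQ : X * (1 - X * W) = 0 := by
    rw [hc, Matrix.mul_sub, Matrix.mul_one, ← Matrix.mul_assoc, hXWX, sub_self]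
  refine ⟨1 - X * W, W, ?_, ?_, hXQ, by simp⟩
  · rw [transpose_sub, transpose_mul, hW, hXt, transpose_one, hc]
  · rw [Matrix.sub_mul, Matrix.one_mul, hc, Matrix.mul_assoc, ← hc, hXQ, Matrix.mul_zero, sub_zero]

/-- The difference is S(1 - Q) + (1 - Q)SQ; the second term involves the transpose of S(1 - Q), and
1 - Q = XW exposes the factor SX. -/
theorem norm_sub_compression_le {S X Q W : SqMat n} (hS : Sᵀ = S) (hQ : Qᵀ = Q)
    (hW : 1 - Q = X * W) : ‖S - Q * S * Q‖ ≤ ‖S * X‖ * (‖W‖ * (1 + ‖Q‖)) := by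
  have h1 : ‖S * (1 - Q)‖ ≤ ‖S * X‖ * ‖W‖ := by
    rw [hW, ← Matrix.mul_assoc]
    exact norm_mul_le _ _
  have h2 : S - Q * S * Q = S * (1 - Q) + (S * (1 - Q))ᵀ * Q := by
    rw [transpose_mul, transpose_sub, transpose_one, hQ, hS]
    noncomm_ring
  calc ‖S - Q * S * Q‖ ≤ ‖S * (1 - Q)‖ + ‖S * (1 - Q)‖ * ‖Q‖ := by
        rw [h2]
        refine (norm_add_le _ _).trans (add_le_add_right ((norm_mul_le _ _).trans ?_) _)
        rw [frobenius_norm_transpose]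
    _ = ‖S * (1 - Q)‖ * (1 + ‖Q‖) := by ring
    _ ≤ ‖S * X‖ * ‖W‖ * (1 + ‖Q‖) := by gcongr
    _ = _ := by ring

theorem compression_eq_self {S X Q W : SqMat n} (hS : Sᵀ = S) (hQ : Qᵀ = Q)
    (hW : 1 - Q = X * W) (h0 : S * X = 0) : Q * S * Q = S := by
  have := norm_sub_compression_le hS hQ hW
  rw [h0, norm_zero, zero_mul] at this
  exact (sub_eq_zero.mp (norm_le_zero_iff.mp this)).symm

/-- The linear map `M ↦ Q ((M + Mᵀ) / 2) Q`. -/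
noncomputable def symmCompression (Q : SqMat n) : SqMat n →ₗ[ℝ] SqMat n where
  toFun M := Q * ((1 / 2 : ℝ) • (M + Mᵀ)) * Q
  map_add' M N := by
    rw [transpose_add, show M + N + (Mᵀ + Nᵀ) = (M + Mᵀ) + (N + Nᵀ) by abel]
    simp only [smul_add, Matrix.mul_add, Matrix.add_mul]
  map_smul' c M := by
    simp only [transpose_smul, ← smul_add, RingHom.id_apply]
    rw [smul_comm, Matrix.mul_smul, Matrix.smul_mul]

theorem symmCompression_apply_of_isSymm {Q M : SqMat n} (hM : Mᵀ = M) :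
    symmCompression Q M = Q * M * Q := by
  change Q * ((1 / 2 : ℝ) • (M + Mᵀ)) * Q = _
  rw [hM, ← two_smul ℝ M, smul_smul]
  norm_num

theorem symmCompression_transpose {Q : SqMat n} (hQ : Qᵀ = Q) (M : SqMat n) :
    (symmCompression Q M)ᵀ = symmCompression Q M := by
  change (Q * ((1 / 2 : ℝ) • (M + Mᵀ)) * Q)ᵀ = Q * ((1 / 2 : ℝ) • (M + Mᵀ)) * Q
  simp only [transpose_mul, transpose_smul, transpose_add, transpose_transpose, hQ,
    Matrix.mul_assoc, add_comm]

theorem compression_symmCompression {Q : SqMat n} (hQQ : Q * Q = Q) (M : SqMat n) :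
    Q * symmCompression Q M * Q = symmCompression Q M := by
  change Q * (Q * ((1 / 2 : ℝ) • (M + Mᵀ)) * Q) * Q = Q * ((1 / 2 : ℝ) • (M + Mᵀ)) * Q
  rw [show Q * (Q * ((1 / 2 : ℝ) • (M + Mᵀ)) * Q) * Q =
    (Q * Q) * ((1 / 2 : ℝ) • (M + Mᵀ)) * (Q * Q) by simp only [Matrix.mul_assoc], hQQ]

theorem norm_symmCompression_le (Q M : SqMat n) : ‖symmCompression Q M‖ ≤ ‖Q‖ ^ 2 * ‖M‖ := by
  have h1 : ‖(1 / 2 : ℝ) • (M + Mᵀ)‖ ≤ ‖M‖ := by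
    have := norm_add_le M Mᵀ
    rw [frobenius_norm_transpose] at this
    rw [norm_smul]
    norm_num
    linarith
  calc ‖Q * ((1 / 2 : ℝ) • (M + Mᵀ)) * Q‖ ≤ ‖Q‖ * ‖(1 / 2 : ℝ) • (M + Mᵀ)‖ * ‖Q‖ :=
        (norm_mul_le _ _).trans (mul_le_mul_of_nonneg_right (norm_mul_le _ _) (norm_nonneg _))
    _ ≤ ‖Q‖ * ‖M‖ * ‖Q‖ := by gcongr
    _ = _ := by ring

/-- The error bound for the entrywise inequalities `S ≤ B` together with `0 ≤ tr S`
on the space of symmetric `S` with `Q S Q = S`. -/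
theorem exists_error_bound_entrywise {Q B S₀ : SqMat n} (hQ : Qᵀ = Q) (hQQ : Q * Q = Q)
    (hS₀ : S₀.PosSemidef) (hQS₀ : Q * S₀ * Q = S₀) (hB : ∀ i j, S₀ i j ≤ B i j) :
    ∃ K : ℝ, 0 ≤ K ∧ ∀ (S : SqMat n) (η : ℝ), S.PosSemidef → Q * S * Q = S → 0 ≤ η →
      (∀ i j, S i j ≤ B i j + η) →
      ∃ Y : SqMat n, Yᵀ = Y ∧ Q * Y * Q = Y ∧ (∀ i j, Y i j ≤ B i j) ∧ 0 ≤ Y.trace ∧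
        ‖S - Y‖ ≤ K * η := by
  let L := symmCompression Q
  have hL : ∀ S : SqMat n, S.PosSemidef → Q * S * Q = S → L S = S := fun S hS hQS =>
    (symmCompression_apply_of_isSymm (posSemidef_isSymm hS)).trans hQS
  -- Composing with `L` builds symmetry and QYQ = Y into the functionals, so Hoffman's bound applies
  -- on the full matrix space. The index `none` carries the trace inequality.
  let a : Option (Fin n × Fin n) → SqMat n →ₗ[ℝ] ℝ := fun o =>
    o.elim (-(traceLinearMap (Fin n) ℝ ℝ ∘ₗ L))
      fun q => entryLinearMap ℝ ℝ q.1 q.2 ∘ₗ L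
  let b : Option (Fin n × Fin n) → ℝ := fun o => o.elim 0 fun q => B q.1 q.2
  have ha0 : ∀ M, a none M = -(L M).trace := fun M => rfl
  have ha : ∀ q M, a (some q) M = L M q.1 q.2 := fun q M => rfl
  obtain ⟨C, hC, h⟩ := hoffman a b ⟨S₀, fun o => by
    cases o with
    | none => rw [ha0, hL S₀ hS₀ hQS₀]; exact neg_nonpos.mpr hS₀.trace_nonneg
    | some q => rw [ha, hL S₀ hS₀ hQS₀]; exact hB _ _⟩
  refine ⟨‖Q‖ ^ 2 * C, by positivity, fun S η hS hQS hη hSB => ?_⟩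
  obtain ⟨y, hy, hSy⟩ := h S η hη fun o => by
    cases o with
    | none =>
      rw [ha0, hL S hS hQS]
      have := hS.trace_nonneg
      change -S.trace ≤ 0 + η
      linarith
    | some q => rw [ha, hL S hS hQS]; exact hSB _ _
  refine ⟨L y, symmCompression_transpose hQ y, compression_symmCompression hQQ y,
    fun i j => hy (some (i, j)), neg_nonpos.mp (hy none), ?_⟩
  have hle := norm_symmCompression_le Q (S - y)
  rw [map_sub, hL S hS hQS] at hle
  refine hle.trans ?_
  rw [mul_assoc]
  gcongr

/-- The error bound for the entrywise inequalities `S ≤ B` on a face of the positive semidefinite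
cone, under the rank condition. -/
theorem exists_error_bound_face {X Q W B S₀ : SqMat n} (hX : X.PosSemidef) (hQ : Qᵀ = Q)
    (hQQ : Q * Q = Q) (hXQ : X * Q = 0) (hW : 1 - Q = X * W)
    (hS₀ : S₀.PosSemidef) (hXS₀ : S₀ * X = 0) (hB : ∀ i j, S₀ i j ≤ B i j)
    (hcond : n ≤ X.rank + 1 ∨ X.rank + S₀.rank = n) {ρ : ℝ} (hρ : 0 ≤ ρ) :
    ∃ K : ℝ, 0 ≤ K ∧ ∀ (S : SqMat n) (η : ℝ), S.PosSemidef → Q * S * Q = S → ‖S‖ ≤ ρ → 0 ≤ η →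
      (∀ i j, S i j ≤ B i j + η) →
      ∃ Y : SqMat n, Y.PosSemidef ∧ (∀ i j, Y i j ≤ B i j) ∧ ‖S - Y‖ ≤ K * η := by
  have hXt := posSemidef_isSymm hX
  have hQS₀ := compression_eq_self (posSemidef_isSymm hS₀) hQ hW hXS₀
  obtain ⟨K, hK, h⟩ := exists_error_bound_entrywise hQ hQQ hS₀ hQS₀ hB
  rcases hcond with hr | hr
  · refine ⟨K, hK, fun S η hS hQS _ hη hSB => ?_⟩
    obtain ⟨Y, hYt, hQY, hYB, hYtr, hSY⟩ := h S η hS hQS hη hSB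
    refine ⟨Y, posSemidef_of_rank_le_one hYt ?_ hYtr, hYB, hSY⟩
    have hXY : X * Y = 0 := by
      rw [← hQY, ← Matrix.mul_assoc, ← Matrix.mul_assoc, hXQ, Matrix.zero_mul, Matrix.zero_mul]
    have := rank_add_rank_le_card_of_mul_eq_zero hXY
    rw [Fintype.card_fin] at this
    omega
  · have hXS₀' : X * S₀ = 0 := by
      have := congrArg transpose hXS₀
      rwa [transpose_mul, hXt, posSemidef_isSymm hS₀, transpose_zero] at this
    obtain ⟨c, hc, hcpsd⟩ :=
      posDef_exists_sub_smul_one (posDef_add_of_rank_add_rank hS₀ hX hXS₀' hr)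
    -- Compressing S₀ + X ≥ c·1 by Q kills X and leaves S₀ ≥ cQ, so S₀ absorbs perturbations inside
    -- the face.
    have hslater : ∀ (M : SqMat n) (β : ℝ), Mᵀ = M → Q * M * Q = M → ‖M‖ ≤ β →
        (β • S₀ + c • M).PosSemidef := by
      intro M β hM hQM hMβ
      have hβ : 0 ≤ β := (norm_nonneg M).trans hMβ
      have hcM : ‖c • M‖ ≤ c * β := by
        rw [norm_smul, Real.norm_of_nonneg hc.le]
        gcongr
      have hcMt : (c • M).IsHermitian := by
        change (c • M)ᵀ = c • M
        rw [transpose_smul, hM]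
      have h1 := ((hcpsd.smul hβ).add
        (posSemidef_add_smul_one hcMt hcM)).mul_mul_conjTranspose_same Q
      have hQc : Qᴴ = Q := hQ
      rw [hQc] at h1
      convert h1 using 1
      rw [show β • (S₀ + X - c • (1 : SqMat n)) + (c • M + (c * β) • (1 : SqMat n)) =
        β • S₀ + β • X + c • M by module,
        Matrix.mul_add, Matrix.mul_add, Matrix.add_mul, Matrix.add_mul]
      simp only [Matrix.mul_smul, Matrix.smul_mul]
      rw [hQS₀, hQM, Matrix.mul_assoc, hXQ, Matrix.mul_zero, smul_zero, add_zero]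
    -- The second term pays for the convex step towards S₀: its weight is at most Kη/c and ‖S - S₀‖
    -- ≤ ρ + ‖S₀‖.
    refine ⟨K + K / c * (ρ + ‖S₀‖), by positivity, fun S η hS hQS hSρ hη hSB => ?_⟩
    obtain ⟨Y, hYt, hQY, hYB, -, hSY⟩ := h S η hS hQS hη hSB
    set β := K * η with hβ
    have hβ0 : 0 ≤ β := by positivity
    have hcβ : 0 < c + β := by positivity
    have hpsd : (c • Y + β • S₀).PosSemidef := by
      have h1 := hslater (Y - S) β (by rw [transpose_sub, hYt, posSemidef_isSymm hS])
        (by rw [Matrix.mul_sub, Matrix.sub_mul, hQY, hQS]) (by rwa [norm_sub_rev])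
      have h2 := (hS.smul hc.le).add h1
      rwa [show c • S + (β • S₀ + c • (Y - S)) = c • Y + β • S₀ by module] at h2
    refine ⟨(c + β)⁻¹ • (c • Y + β • S₀), hpsd.smul (by positivity), fun i j => ?_, ?_⟩
    · simp only [Matrix.smul_apply, Matrix.add_apply, smul_eq_mul]
      rw [inv_mul_le_iff₀ hcβ, add_mul]
      exact add_le_add (mul_le_mul_of_nonneg_left (hYB i j) hc.le)
        (mul_le_mul_of_nonneg_left (hB i j) hβ0)
    · have hone : (c + β)⁻¹ * c = 1 - (c + β)⁻¹ * β := by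
        field_simp
        ring
      have hdecomp : S - (c + β)⁻¹ • (c • Y + β • S₀) =
          ((c + β)⁻¹ * c) • (S - Y) + ((c + β)⁻¹ * β) • (S - S₀) := by
        rw [smul_add, smul_smul, smul_smul, hone]
        module
      have hle1 : (c + β)⁻¹ * c ≤ 1 := by
        rw [inv_mul_le_iff₀ hcβ]
        linarith
      have hleβ : (c + β)⁻¹ * β ≤ β / c := by
        rw [inv_mul_eq_div]
        gcongr
        linarith
      have hS₀ρ : ‖S - S₀‖ ≤ ρ + ‖S₀‖ := (norm_sub_le _ _).trans (by gcongr)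
      calc ‖S - (c + β)⁻¹ • (c • Y + β • S₀)‖
          ≤ ‖((c + β)⁻¹ * c) • (S - Y)‖ + ‖((c + β)⁻¹ * β) • (S - S₀)‖ := by
            rw [hdecomp]
            exact norm_add_le _ _
        _ = ((c + β)⁻¹ * c) * ‖S - Y‖ + ((c + β)⁻¹ * β) * ‖S - S₀‖ := by
            rw [norm_smul, norm_smul, Real.norm_of_nonneg (by positivity),
              Real.norm_of_nonneg (by positivity)]
        _ ≤ 1 * β + β / c * (ρ + ‖S₀‖) := by gcongr
        _ = (K + K / c * (ρ + ‖S₀‖)) * η := by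
            rw [hβ]
            ring

/-! ### Optimality conditions of the dual problem. -/

theorem dualObj_expand (G : SqMat n) (p q : MatPair n) :
    dualObj G q = dualObj G p
      + frobInner (p.fst + p.snd + G) (q.fst + q.snd - (p.fst + p.snd))
      + 1 / 2 * ‖q.fst + q.snd - (p.fst + p.snd)‖ ^ 2 := by
  have h := norm_add_sq_frobInner (p.fst + p.snd + G) (q.fst + q.snd - (p.fst + p.snd))
  rw [show p.fst + p.snd + G + (q.fst + q.snd - (p.fst + p.snd)) = q.fst + q.snd + G by abel] at h
  unfold dualObj
  linarith

/-- First-order optimality: the directional derivative along a feasible change of the sum S + Z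
cannot be negative. -/
theorem dualSol_variation {G : SqMat n} {p : MatPair n} (hp : p ∈ dualSol G) {A : SqMat n}
    (hA : ∀ t : ℝ, 0 < t → t ≤ 1 → ∃ S ∈ psdCone n, ∃ Z ∈ nonnegCone n,
      S + Z = p.fst + p.snd + t • A) :
    0 ≤ frobInner (p.fst + p.snd + G) A := by
  by_contra hneg
  set a := frobInner (p.fst + p.snd + G) A with ha
  have ha0 : a < 0 := not_le.mp hneg
  have hpos : 0 < ‖A‖ ^ 2 - a := by linarith [sq_nonneg ‖A‖]
  -- This step length lies in (0, 1] and makes t‖A‖² = -a + ta, so a + ½t‖A‖² = ½a(1 + t) < 0.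
  obtain ⟨S, hS, Z, hZ, hSZ⟩ := hA (-a / (‖A‖ ^ 2 - a)) (div_pos (neg_pos.mpr ha0) hpos)
    ((div_le_one hpos).mpr (by linarith [sq_nonneg ‖A‖]))
  set t := -a / (‖A‖ ^ 2 - a) with ht
  have ht0 : 0 < t := div_pos (neg_pos.mpr ha0) hpos
  have hmin : dualObj G p ≤ dualObj G (WithLp.toLp 2 (S, Z)) := hp.2 ⟨hS, hZ⟩
  have hexp := dualObj_expand G p (WithLp.toLp 2 (S, Z))
  simp only [WithLp.toLp_fst, WithLp.toLp_snd] at hexp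
  rw [hSZ, add_sub_cancel_left, frobInner_smul_right, norm_smul, Real.norm_of_nonneg ht0.le,
    ← ha] at hexp
  have h1 : 0 ≤ t * (a + 1 / 2 * (t * ‖A‖ ^ 2)) := by nlinarith
  have h2 : 0 ≤ a + 1 / 2 * (t * ‖A‖ ^ 2) := nonneg_of_mul_nonneg_right h1 ht0
  have h3 : t * (‖A‖ ^ 2 - a) = -a := div_mul_cancel₀ _ hpos.ne'
  nlinarith [mul_pos ht0 (neg_pos.mpr ha0)]

theorem psdCone_smul_mem {S : SqMat n} (hS : S ∈ psdCone n) {t : ℝ} (ht : 0 ≤ t) :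
    t • S ∈ psdCone n := PosSemidef.smul hS ht

theorem nonnegCone_smul_mem {Z : SqMat n} (hZ : Z ∈ nonnegCone n) {t : ℝ} (ht : 0 ≤ t) :
    t • Z ∈ nonnegCone n :=
  ⟨by rw [IsSymm, transpose_smul, hZ.1], fun i j => mul_nonneg ht (hZ.2 i j)⟩

theorem nonnegCone_add_mem {Z Y : SqMat n} (hZ : Z ∈ nonnegCone n) (hY : Y ∈ nonnegCone n) :
    Z + Y ∈ nonnegCone n :=
  ⟨hZ.1.add hY.1, fun i j => add_nonneg (hZ.2 i j) (hY.2 i j)⟩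

theorem dualSol_frobInner_psd_nonneg {G : SqMat n} {p : MatPair n} (hp : p ∈ dualSol G)
    {A : SqMat n} (hA : A ∈ psdCone n) : 0 ≤ frobInner (p.fst + p.snd + G) A :=
  dualSol_variation hp fun t ht _ => ⟨p.fst + t • A,
    PosSemidef.add hp.1.1 (psdCone_smul_mem hA ht.le), p.snd, hp.1.2, by abel⟩

theorem dualSol_frobInner_nonnegCone_nonneg {G : SqMat n} {p : MatPair n} (hp : p ∈ dualSol G)
    {A : SqMat n} (hA : A ∈ nonnegCone n) : 0 ≤ frobInner (p.fst + p.snd + G) A :=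
  dualSol_variation hp fun t ht _ => ⟨p.fst, hp.1.1, p.snd + t • A,
    nonnegCone_add_mem hp.1.2 (nonnegCone_smul_mem hA ht.le), by abel⟩

theorem dualSol_frobInner_fst {G : SqMat n} {p : MatPair n} (hp : p ∈ dualSol G) :
    frobInner (p.fst + p.snd + G) p.fst = 0 := by
  refine le_antisymm ?_ (dualSol_frobInner_psd_nonneg hp hp.1.1)
  have h := dualSol_variation hp (A := (-1 : ℝ) • p.fst) fun t _ ht =>
    ⟨(1 - t) • p.fst, psdCone_smul_mem hp.1.1 (sub_nonneg.mpr ht), p.snd, hp.1.2, by module⟩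
  rw [frobInner_smul_right] at h
  linarith

theorem dualSol_frobInner_snd {G : SqMat n} {p : MatPair n} (hp : p ∈ dualSol G) :
    frobInner (p.fst + p.snd + G) p.snd = 0 := by
  refine le_antisymm ?_ (dualSol_frobInner_nonnegCone_nonneg hp hp.1.2)
  have h := dualSol_variation hp (A := (-1 : ℝ) • p.snd) fun t _ ht =>
    ⟨p.fst, hp.1.1, (1 - t) • p.snd, nonnegCone_smul_mem hp.1.2 (sub_nonneg.mpr ht), by module⟩
  rw [frobInner_smul_right] at h
  linarith

/-- Self-duality of both cones among symmetric matrices, tested on vvᵀ and on the symmetrized matrix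
units. -/
theorem dualSol_residual_mem_dnnCone {G : SqMat n} (hG : G.IsSymm) {p : MatPair n}
    (hp : p ∈ dualSol G) : p.fst + p.snd + G ∈ dnnCone n := by
  have hsymm : (p.fst + p.snd + G).IsSymm :=
    (IsSymm.add (posSemidef_isSymm hp.1.1) hp.1.2.1).add hG
  refine ⟨PosSemidef.of_dotProduct_mulVec_nonneg hsymm fun v => ?_, hsymm, fun i j => ?_⟩
  · have h := dualSol_frobInner_psd_nonneg hp (A := vecMulVec v v)
      (posSemidef_vecMulVec_self_star v)
    rwa [frobInner_vecMulVec] at h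
  · have hmem : single i j (1 : ℝ) + single j i 1 ∈ nonnegCone n := by
      refine ⟨?_, fun k l => ?_⟩
      · rw [IsSymm, transpose_add, transpose_single, transpose_single, add_comm]
      · simp only [Matrix.add_apply, single_apply]
        positivity
    have h := dualSol_frobInner_nonnegCone_nonneg hp hmem
    have hentry : ∀ (M : SqMat n) k l, frobInner M (single k l 1) = M k l := fun M k l => by
      simp [frobInner, trace_mul_single]
    rw [frobInner_add_right, hentry, hentry, hsymm.apply i j] at h
    linarith

/-- The residual of every dual solution is the primal solution. -/
theorem dualSol_add_add_eq {G : SqMat n} (hG : G.IsSymm) {X : SqMat n} (hX : X ∈ primalSol G)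
    {p : MatPair n} (hp : p ∈ dualSol G) : p.fst + p.snd + G = X := by
  set V := p.fst + p.snd + G with hV
  have hVmem : V ∈ dnnCone n := dualSol_residual_mem_dnnCone hG hp
  have hmin : primalObj G X ≤ primalObj G V := hX.2 hVmem
  -- Complementarity gives ⟨V, V - G⟩ = 0, so ‖X - G‖² exceeds ‖V - G‖² by at least ‖X - V‖²;
  -- minimality of X forces X = V.
  have hexp := norm_add_sq_frobInner (X - V) (V - G)
  rw [sub_add_sub_cancel, show V - G = p.fst + p.snd by rw [hV]; abel] at hexp
  have h1 : frobInner (X - V) (p.fst + p.snd) = frobInner X p.fst + frobInner X p.snd := by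
    have h2 : frobInner V (p.fst + p.snd) = 0 := by
      rw [frobInner_add_right, dualSol_frobInner_fst hp, dualSol_frobInner_snd hp, add_zero]
    rw [frobInner_comm, frobInner_sub_right, frobInner_comm _ V, h2, sub_zero, frobInner_comm,
      frobInner_add_right]
  have h2 : 0 ≤ frobInner X p.fst := posSemidef_frobInner_nonneg hX.1.1 hp.1.1
  have h3 : 0 ≤ frobInner X p.snd := nonneg_frobInner_nonneg hX.1.2.2 hp.1.2.2
  have h4 : V - G = p.fst + p.snd := by rw [hV]; abel
  unfold primalObj at hmin
  rw [h4] at hmin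
  have h5 : ‖X - V‖ ^ 2 ≤ 0 := by linarith
  exact (sub_eq_zero.mp (norm_eq_zero.mp
    (pow_eq_zero_iff two_ne_zero |>.mp (le_antisymm h5 (sq_nonneg _))))).symm

theorem mem_dualSol_of_add_eq {G : SqMat n} {p q : MatPair n} (hp : p ∈ dualSol G)
    (hq : q ∈ dualFeasible n) (h : q.fst + q.snd = p.fst + p.snd) : q ∈ dualSol G := by
  refine ⟨hq, fun r hr => ?_⟩
  have : dualObj G q = dualObj G p := by simp only [dualObj, h]
  change dualObj G q ≤ dualObj G r
  rw [this]
  exact hp.2 hr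

/-- The distance of a positive semidefinite matrix to the face exposed by `X` is of the order of
the square root of its inner product with `X`, on bounded sets. -/
theorem exists_norm_sub_compression_le_sqrt {X Q W : SqMat n} (hX : X.PosSemidef) (hQ : Qᵀ = Q)
    (hW : 1 - Q = X * W) (ρ : ℝ) :
    ∃ C : ℝ, 0 ≤ C ∧ ∀ S : SqMat n, S.PosSemidef → ‖S‖ ≤ ρ →
      ‖S - Q * S * Q‖ ≤ C * √(frobInner X S) := by
  refine ⟨√(‖(1 : SqMat n)‖ * ρ * X.trace) * (‖W‖ * (1 + ‖Q‖)), by positivity, fun S hS hSρ => ?_⟩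
  have hXS := posSemidef_frobInner_nonneg hX hS
  have h1 : ‖S * X‖ ≤ √(‖(1 : SqMat n)‖ * ρ * X.trace) * √(frobInner X S) := by
    rw [← Real.sqrt_mul' _ hXS]
    refine Real.le_sqrt_of_sq_le ((norm_mul_sq_le_of_posSemidef hS hX).trans ?_)
    rw [frobInner_comm S X]
    have htr : S.trace ≤ ‖(1 : SqMat n)‖ * ρ := (trace_le_norm S).trans (by gcongr)
    exact mul_le_mul_of_nonneg_right (mul_le_mul_of_nonneg_right htr hX.trace_nonneg) hXS
  refine (norm_sub_compression_le (posSemidef_isSymm hS) hQ hW).trans ?_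
  calc ‖S * X‖ * (‖W‖ * (1 + ‖Q‖))
      ≤ √(‖(1 : SqMat n)‖ * ρ * X.trace) * √(frobInner X S) * (‖W‖ * (1 + ‖Q‖)) := by gcongr
    _ = _ := by ring

end

/-! ### Quadratic growth. -/

open Matrix

theorem mainTheorem2 (n : ℕ) (G : SqMat n) (hG : G.IsSymm)
    (Xbar : SqMat n) (hX : Xbar ∈ primalSol G)
    (hcond : n ≤ Xbar.rank + 1 ∨ ∃ q ∈ dualSol G, Xbar.rank + q.fst.rank = n) :
    ∀ p ∈ dualSol G, QuadraticGrowthAt (dualObj G) (dualFeasible n) p := by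
  intro p hp
  obtain ⟨q, hq, hr⟩ : ∃ q ∈ dualSol G, n ≤ Xbar.rank + 1 ∨ Xbar.rank + q.fst.rank = n := by
    rcases hcond with h | ⟨q, hq, h⟩
    · exact ⟨p, hp, Or.inl h⟩
    · exact ⟨q, hq, Or.inr h⟩
  have hXpsd : Xbar.PosSemidef := hX.1.1
  have hpX : p.fst + p.snd + G = Xbar := dualSol_add_add_eq hG hX hp
  have hqX : q.fst + q.snd + G = Xbar := dualSol_add_add_eq hG hX hq
  set B := p.fst + p.snd with hB
  have hqB : q.fst + q.snd = B := add_right_cancel (hqX.trans hpX.symm)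
  have hBsymm : B.IsSymm := IsSymm.add (posSemidef_isSymm hp.1.1) hp.1.2.1
  have hqX0 : q.fst * Xbar = 0 := posSemidef_mul_eq_zero hq.1.1 hXpsd (by
    rw [frobInner_comm, ← hqX]
    exact dualSol_frobInner_fst hq)
  have hqle : ∀ i j, q.fst i j ≤ B i j := fun i j => by
    have := hq.1.2.2 i j
    rw [← hqB, Matrix.add_apply]
    linarith
  obtain ⟨Q, W, hQ, hQQ, hXQ, hW⟩ := exists_kernel_projection hXpsd.1
  obtain ⟨C, hC, hface⟩ :=
    exists_norm_sub_compression_le_sqrt hXpsd hQ hW (‖p.fst‖ + 1)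
  obtain ⟨K, hK, herr⟩ := exists_error_bound_face hXpsd hQ hQQ hXQ hW hq.1.1 hqX0 hqle hr
    (ρ := ‖Q‖ * (‖p.fst‖ + 1) * ‖Q‖) (by positivity)
  -- The constant combines dist² ≤ 2(K + 2)²η² with the bound of η² by 4 + 2C² times the excess.
  -- Radius 1 only serves to bound ‖S‖.
  refine ⟨(2 * (K + 2) ^ 2 * (4 + 2 * C ^ 2))⁻¹, by positivity, 1, one_pos, ?_⟩
  rintro x ⟨hxball, hxS, hxZ⟩
  set S := x.fst with hSdef
  set Z := x.snd with hZdef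
  have hSnorm : ‖S‖ ≤ ‖p.fst‖ + 1 := by
    have h1 : ‖x - p‖ ≤ 1 := by rwa [← dist_eq_norm]
    have h2 : ‖S - p.fst‖ ≤ ‖x - p‖ := by
      have h3 := WithLp.prod_norm_sq_eq_of_L2 (x - p)
      refine (sq_le_sq₀ (norm_nonneg _) (norm_nonneg _)).mp ?_
      rw [h3, WithLp.sub_fst, WithLp.sub_snd]
      linarith [sq_nonneg ‖x.snd - p.snd‖]
    have h4 := norm_le_norm_add_norm_sub' S p.fst
    linarith
  have hXS : 0 ≤ frobInner Xbar S := posSemidef_frobInner_nonneg hXpsd hxS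
  have hXZ : 0 ≤ frobInner Xbar Z := nonneg_frobInner_nonneg hX.1.2.2 hxZ.2
  set D := S + Z - B with hD
  set η := ‖D‖ + C * √(frobInner Xbar S) with hη
  have hη0 : 0 ≤ η := by positivity
  have hSS' := hface S hxS hSnorm
  have hQc : Qᴴ = Q := hQ
  have hS'psd : (Q * S * Q).PosSemidef := by
    have := PosSemidef.mul_mul_conjTranspose_same hxS Q
    rwa [hQc] at this
  have hQS'Q : Q * (Q * S * Q) * Q = Q * S * Q := by
    rw [show Q * (Q * S * Q) * Q = (Q * Q) * S * (Q * Q) by simp only [Matrix.mul_assoc], hQQ]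
  have hS'norm : ‖Q * S * Q‖ ≤ ‖Q‖ * (‖p.fst‖ + 1) * ‖Q‖ := by
    refine (norm_mul_le _ _).trans (mul_le_mul_of_nonneg_right ?_ (norm_nonneg _))
    exact (norm_mul_le _ _).trans (mul_le_mul_of_nonneg_left hSnorm (norm_nonneg _))
  -- Since Z ≥ 0, S = B - Z + D exceeds B entrywise by at most ‖D‖; compression adds at most C√⟨X,
  -- S⟩.
  obtain ⟨Y, hYpsd, hYB, hYS⟩ := herr (Q * S * Q) η hS'psd hQS'Q hS'norm hη0 fun i j => by
    have h1 := (abs_le.mp (abs_entry_le_norm (S - Q * S * Q) i j)).1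
    have h2 := (abs_le.mp (abs_entry_le_norm D i j)).2
    have h3 := hxZ.2 i j
    simp only [hD, Matrix.sub_apply, Matrix.add_apply] at h1 h2
    linarith
  have hSY : ‖S - Y‖ ≤ (K + 1) * η := by
    have h1 := norm_sub_le_norm_sub_add_norm_sub S (Q * S * Q) Y
    have h2 : C * √(frobInner Xbar S) ≤ η := by
      rw [hη]
      linarith [norm_nonneg D]
    linarith
  have hymem : (WithLp.toLp 2 (Y, B - Y) : MatPair n) ∈ dualSol G := by
    refine mem_dualSol_of_add_eq hp ⟨hYpsd, ?_, fun i j => ?_⟩ (by simp [hB])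
    · exact hBsymm.sub (posSemidef_isSymm hYpsd)
    · exact sub_nonneg.mpr (hYB i j)
  have hZY : ‖Z - (B - Y)‖ ≤ (K + 2) * η := by
    have h1 : Z - (B - Y) = D - (S - Y) := by
      rw [hD]
      abel
    have h2 : ‖D‖ ≤ η := by
      rw [hη]
      linarith [mul_nonneg hC (Real.sqrt_nonneg (frobInner Xbar S))]
    rw [h1]
    refine (norm_sub_le _ _).trans ?_
    linarith
  have hdist : Metric.infDist x (dualSol G) ^ 2 ≤ 2 * (K + 2) ^ 2 * η ^ 2 := by
    have h1 := Metric.infDist_le_dist_of_mem (x := x) hymem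
    have h2 := pow_le_pow_left₀ Metric.infDist_nonneg h1 2
    rw [dist_eq_norm, WithLp.prod_norm_sq_eq_of_L2] at h2
    change _ ≤ ‖S - Y‖ ^ 2 + ‖Z - (B - Y)‖ ^ 2 at h2
    have h3 : ‖S - Y‖ ^ 2 ≤ ((K + 2) * η) ^ 2 :=
      pow_le_pow_left₀ (norm_nonneg _) (by linarith) 2
    have h4 : ‖Z - (B - Y)‖ ^ 2 ≤ ((K + 2) * η) ^ 2 :=
      pow_le_pow_left₀ (norm_nonneg _) hZY 2
    rw [mul_pow] at h3 h4
    linarith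
  have hobj : dualObj G x = dualObj G p + (frobInner Xbar S + frobInner Xbar Z) +
      1 / 2 * ‖D‖ ^ 2 := by
    have h1 := dualObj_expand G p x
    rw [← hB, hpX, ← hSdef, ← hZdef, ← hD] at h1
    have h2 : frobInner Xbar B = 0 := by
      rw [← hpX, hB, frobInner_add_right, dualSol_frobInner_fst hp, dualSol_frobInner_snd hp,
        add_zero]
    have h3 : frobInner Xbar D = frobInner Xbar S + frobInner Xbar Z := by
      rw [hD, frobInner_sub_right, h2, sub_zero, frobInner_add_right]
    rw [h1, h3]
  have hηsq : η ^ 2 ≤ (4 + 2 * C ^ 2) * (frobInner Xbar S + 1 / 2 * ‖D‖ ^ 2) := by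
    have h1 := Real.sq_sqrt hXS
    have h2 : η ^ 2 ≤ 2 * ‖D‖ ^ 2 + 2 * C ^ 2 * frobInner Xbar S := by
      rw [← h1, hη]
      nlinarith [sq_nonneg (‖D‖ - C * √(frobInner Xbar S))]
    nlinarith [mul_nonneg (sq_nonneg C) (sq_nonneg ‖D‖)]
  have hfinal : (2 * (K + 2) ^ 2 * (4 + 2 * C ^ 2))⁻¹ * Metric.infDist x (dualSol G) ^ 2 ≤
      frobInner Xbar S + 1 / 2 * ‖D‖ ^ 2 := by
    rw [inv_mul_le_iff₀ (by positivity)]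
    calc _ ≤ 2 * (K + 2) ^ 2 * η ^ 2 := hdist
      _ ≤ 2 * (K + 2) ^ 2 * ((4 + 2 * C ^ 2) * (frobInner Xbar S + 1 / 2 * ‖D‖ ^ 2)) := by
          gcongr
      _ = _ := by ring
  change dualObj G x ≥ dualObj G p + _ * Metric.infDist x (dualSol G) ^ 2
  linarith
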